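/- Let $N\ge 1$ and let $\Phi=\{\varphi_i\}_{i=1}^M\subset\mathbb R^N$ be a unit-norm frame, i.e. $\|\varphi_i\|_2=1$ for all $i$ and there are constants $0<A\le B<\infty$ with $A\|x\|_2^2\le\sum_{i=1}^M|\langle x,\varphi_i\rangle|^2\le B\|x\|_2^2$ for all $x\in\mathbb R^N$. A frame is called tight if one can take $A=B$, and $\Phi$ is called scalable if there are scalars $s_1,\dots,s_M\ge 0$ such that $\{s_i\varphi_i\}_{i=1}^M$ is a tight frame for $\mathbb R^N$. Then the minimum $\min_{\|d\|_2=1}\max_{1\le i\le M}|\langle d,\varphi_i\rangle|$ exists, and the following hold. (a) If $\Phi$ is scalable, then $$\min_{\|d\|_2=1}\max_{1\le i\le M}|\langle d,\varphi_i\rangle|\ \ge\ \frac1{\sqrt N}.$$ (b) If $$\min_{\|d\|_2=1}\max_{1\le i\le M}|\langle d,\varphi_i\rangle|\ \ge\ \sqrt{\frac{N-1}{N}},$$ then $\Phi$ is scalable. -/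

import Mathlib

noncomputable section

namespace ScalableFrames

/-- `Φ` satisfies the two-sided frame inequality with bounds `0 < A` and `B`. -/
def HasFrameBounds {M N : ℕ} (Φ : Fin M → EuclideanSpace ℝ (Fin N)) (A B : ℝ) : Prop :=
  0 < A ∧ ∀ x : EuclideanSpace ℝ (Fin N),
    A * ‖x‖ ^ 2 ≤ ∑ i, |inner ℝ x (Φ i)| ^ 2 ∧ ∑ i, |inner ℝ x (Φ i)| ^ 2 ≤ B * ‖x‖ ^ 2

/-- A finite sequence of vectors is a frame for `ℝ^N`. -/
def IsFrame {M N : ℕ} (Φ : Fin M → EuclideanSpace ℝ (Fin N)) : Prop :=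
  ∃ A B : ℝ, HasFrameBounds Φ A B

/-- A tight frame: the two frame bounds can be chosen equal. -/
def IsTightFrame {M N : ℕ} (Φ : Fin M → EuclideanSpace ℝ (Fin N)) : Prop :=
  ∃ A : ℝ, HasFrameBounds Φ A A

/-- A frame all of whose vectors have Euclidean norm one. -/
def IsUnitNormFrame {M N : ℕ} (Φ : Fin M → EuclideanSpace ℝ (Fin N)) : Prop :=
  IsFrame Φ ∧ ∀ i, ‖Φ i‖ = 1

/-- A scalable frame: nonnegative rescaling of its vectors yields a tight frame. -/
def IsScalable {M N : ℕ} (Φ : Fin M → EuclideanSpace ℝ (Fin N)) : Prop :=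
  IsFrame Φ ∧ ∃ s : Fin M → ℝ, (∀ i, 0 ≤ s i) ∧ IsTightFrame (fun i => s i • Φ i)

/-- `max_i |⟨d, φ_i⟩|`; the supremum is over a finite index set, hence a maximum when `0 < M`. -/
def maxCorrelation {M N : ℕ} (Φ : Fin M → EuclideanSpace ℝ (Fin N))
    (d : EuclideanSpace ℝ (Fin N)) : ℝ :=
  ⨆ i, |inner ℝ d (Φ i)|

/-- The infimum over unit vectors `d` of `max_i |⟨d, φ_i⟩|`. -/
def minMaxCorrelation {M N : ℕ} (Φ : Fin M → EuclideanSpace ℝ (Fin N)) : ℝ :=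
  sInf (maxCorrelation Φ '' {d | ‖d‖ = 1})

end ScalableFrames

end

/-!
Write `n` for the dimension and `m` for the min-max value.

Summing the identity `∑ ‖⟪x, ψ i⟫‖ ^ 2 = A ‖x‖ ^ 2` over an orthonormal basis gives
`∑ ‖ψ i‖ ^ 2 = n A`. If `ψ i = s i • φ i` is a tight rescaling of unit vectors, the identity at a
unit vector `d` attaining `m` reads `A ≤ m ^ 2 ∑ s i ^ 2 = m ^ 2 n A`, so `1 ≤ n m ^ 2`.

Conversely, `φ` is scalable as soon as `n⁻¹ • 1` is a convex combination of the rank one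
projections onto the `φ i`. If it is not, Hahn-Banach yields a symmetric `S` with
`tr S < n ⟪φ i, S φ i⟫` for all `i`. Let `d` be a unit eigenvector for the least eigenvalue of `S`.
A unit vector `x` with `‖⟪d, x⟫‖ ^ 2 ≥ (n - 1) / n` has at most `1 / n` of its mass on the other
eigenvectors, which forces `n ⟪x, S x⟫ ≤ tr S`. So no `φ i` is that close to `d`, and
`m < √((n - 1) / n)`.
-/

namespace ScalableFrames

open Module RCLike InnerProductSpace

variable {𝕜 E ι : Type*} [RCLike 𝕜] [NormedAddCommGroup E] [InnerProductSpace 𝕜 E]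

section Definitions

variable (𝕜)

/-- The largest correlation of `d` with a member of the family `φ`: `maxCorrelation` over `ℝ` or
`ℂ`, for any index type. -/
noncomputable def maxInner (φ : ι → E) (d : E) : ℝ :=
  ⨆ i, ‖⟪d, φ i⟫_𝕜‖

/-- The infimum of `maxInner` over the unit sphere: `minMaxCorrelation` over `ℝ` or `ℂ`, for any
index type. -/
noncomputable def minMaxInner (φ : ι → E) : ℝ :=
  sInf (maxInner 𝕜 φ '' {d | ‖d‖ = 1})

variable [Fintype ι]

/-- `ψ` is a tight frame with frame bound `A`; the two frame inequalities are merged into one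
equality. -/
def HasTightBound (ψ : ι → E) (A : ℝ) : Prop :=
  0 < A ∧ ∀ x, ∑ i, ‖⟪x, ψ i⟫_𝕜‖ ^ 2 = A * ‖x‖ ^ 2

/-- Some nonnegative rescaling of `φ` is a tight frame: scalability over `ℝ` or `ℂ`. -/
def HasTightScaling (φ : ι → E) : Prop :=
  ∃ s : ι → ℝ, (∀ i, 0 ≤ s i) ∧ ∃ A, HasTightBound 𝕜 (fun i => (s i : 𝕜) • φ i) A

end Definitions

section Attainment

variable [Finite ι]

lemma norm_inner_le_maxInner (φ : ι → E) (d : E) (i : ι) : ‖⟪d, φ i⟫_𝕜‖ ≤ maxInner 𝕜 φ d :=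
  le_ciSup (f := fun i => ‖⟪d, φ i⟫_𝕜‖) (Set.finite_range _).bddAbove i

lemma exists_norm_inner_eq_maxInner [Nonempty ι] (φ : ι → E) (d : E) :
    ∃ i, ‖⟪d, φ i⟫_𝕜‖ = maxInner 𝕜 φ d :=
  exists_eq_ciSup_of_finite

lemma continuous_maxInner [Nonempty ι] (φ : ι → E) : Continuous (maxInner 𝕜 φ) := by
  cases nonempty_fintype ι
  have hsup : maxInner 𝕜 φ =
      fun d => Finset.univ.sup' Finset.univ_nonempty fun i => ‖⟪d, φ i⟫_𝕜‖ :=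
    funext fun d => (Finset.sup'_univ_eq_ciSup _).symm
  rw [hsup]
  exact Continuous.finset_sup'_apply _ fun i _ => by fun_prop

lemma isLeast_minMaxInner [FiniteDimensional 𝕜 E] [Nontrivial E] [Nonempty ι] (φ : ι → E) :
    IsLeast (maxInner 𝕜 φ '' {d | ‖d‖ = 1}) (minMaxInner 𝕜 φ) := by
  have : ProperSpace E := FiniteDimensional.proper_rclike 𝕜 E
  have hsphere : {d : E | ‖d‖ = 1} = Metric.sphere 0 1 := by ext d; simp
  obtain ⟨d, hd⟩ : ({d : E | ‖d‖ = 1}).Nonempty := by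
    obtain ⟨v, hv⟩ := exists_ne (0 : E)
    exact ⟨_, norm_smul_inv_norm (𝕜 := 𝕜) hv⟩
  refine IsCompact.isLeast_sInf ?_ ⟨_, d, hd, rfl⟩
  rw [hsphere]
  exact (isCompact_sphere 0 1).image (continuous_maxInner φ)

end Attainment

section Necessity

variable [Fintype ι] [FiniteDimensional 𝕜 E] {ψ : ι → E} {A : ℝ}

lemma HasTightBound.sum_norm_sq (hψ : HasTightBound 𝕜 ψ A) :
    ∑ i, ‖ψ i‖ ^ 2 = finrank 𝕜 E * A := by
  let b := stdOrthonormalBasis 𝕜 E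
  calc ∑ i, ‖ψ i‖ ^ 2
      = ∑ i, ∑ j, ‖⟪b j, ψ i⟫_𝕜‖ ^ 2 := by simp only [b.sum_sq_norm_inner_right]
    _ = ∑ j, ∑ i, ‖⟪b j, ψ i⟫_𝕜‖ ^ 2 := Finset.sum_comm
    _ = finrank 𝕜 E * A := by simp [hψ.2]

lemma HasTightBound.one_le_finrank_mul_sq (hψ : HasTightBound 𝕜 ψ A) {d : E} (hd : ‖d‖ = 1)
    {m : ℝ} (hm : ∀ i, ‖⟪d, ψ i⟫_𝕜‖ ≤ m * ‖ψ i‖) : 1 ≤ finrank 𝕜 E * m ^ 2 := by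
  have hle : A ≤ A * (finrank 𝕜 E * m ^ 2) := calc
    A = ∑ i, ‖⟪d, ψ i⟫_𝕜‖ ^ 2 := by rw [hψ.2, hd]; ring
    _ ≤ ∑ i, (m * ‖ψ i‖) ^ 2 := by gcongr with i; exact hm i
    _ = m ^ 2 * ∑ i, ‖ψ i‖ ^ 2 := by simp only [mul_pow, Finset.mul_sum]
    _ = A * (finrank 𝕜 E * m ^ 2) := by rw [hψ.sum_norm_sq]; ring
  exact (le_mul_iff_one_le_right hψ.1).mp hle

lemma HasTightScaling.one_div_sqrt_le_maxInner {φ : ι → E} (hφ : ∀ i, ‖φ i‖ = 1)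
    (h : HasTightScaling 𝕜 φ) {d : E} (hd : ‖d‖ = 1) :
    1 / √(finrank 𝕜 E) ≤ maxInner 𝕜 φ d := by
  obtain ⟨s, -, A, hA⟩ := h
  have hm : 0 ≤ maxInner 𝕜 φ d := Real.iSup_nonneg fun _ => norm_nonneg _
  have hone : 1 ≤ finrank 𝕜 E * maxInner 𝕜 φ d ^ 2 := by
    refine hA.one_le_finrank_mul_sq hd fun i => ?_
    rw [inner_smul_right, norm_mul, norm_smul, hφ i, mul_one, mul_comm]
    gcongr
    exact norm_inner_le_maxInner φ d i
  refine div_le_of_le_mul₀ (Real.sqrt_nonneg _) hm ?_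
  rw [mul_comm, ← Real.sqrt_sq hm, ← Real.sqrt_mul (Nat.cast_nonneg _)]
  exact Real.one_le_sqrt.mpr hone

end Necessity

section Separation

lemma exists_mem_stdSimplex_or_exists_separating {F : Type*} [NormedAddCommGroup F]
    [NormedSpace 𝕜 F] [Fintype ι] (p : ι → F) (x : F) :
    (∃ w ∈ stdSimplex ℝ ι, ∑ i, (w i : 𝕜) • p i = x) ∨
      ∃ f : StrongDual 𝕜 F, ∀ i, re (f x) < re (f (p i)) := by
  classical
  let _ : NormedSpace ℝ F := NormedSpace.restrictScalars ℝ 𝕜 F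
  have : IsScalarTower ℝ 𝕜 F := IsScalarTower.restrictScalars ℝ 𝕜 F
  let L : (ι → ℝ) →ₗ[ℝ] F := Fintype.linearCombination ℝ p
  have hL (w : ι → ℝ) : L w = ∑ i, (w i : 𝕜) • p i := by
    simp only [L, Fintype.linearCombination_apply, real_smul_eq_coe_smul (K := 𝕜)]
  by_cases hx : x ∈ L '' stdSimplex ℝ ι
  · obtain ⟨w, hw, hwx⟩ := hx
    exact .inl ⟨w, hw, by rw [← hL, hwx]⟩
  · have hclosed : IsClosed (L '' stdSimplex ℝ ι) :=
      ((isCompact_stdSimplex ℝ ι).image L.continuous_of_finiteDimensional).isClosed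
    obtain ⟨f, u, hxu, hu⟩ := RCLike.geometric_hahn_banach_point_closed (𝕜 := 𝕜)
      ((convex_stdSimplex ℝ ι).linear_image L) hclosed hx
    refine .inr ⟨f, fun i => hxu.trans (hu _ ⟨Pi.single i 1, single_mem_stdSimplex ℝ i, ?_⟩)⟩
    simp [L, Fintype.linearCombination_apply_single]

lemma exists_inner_eq_apply_rankOne [CompleteSpace E] (f : StrongDual 𝕜 (E →L[𝕜] E)) :
    ∃ T : E →L[𝕜] E, ∀ x y, ⟪T y, x⟫_𝕜 = f (rankOne 𝕜 x y) := by
  let B : E →L⋆[𝕜] E →L[𝕜] 𝕜 :=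
    (ContinuousLinearMap.compL 𝕜 E (E →L[𝕜] E) 𝕜 f).comp (rankOne 𝕜).flip
  exact ⟨continuousLinearMapOfBilin B, fun x y => continuousLinearMapOfBilin_apply B y x⟩

lemma exists_isSymmetric_re_trace_eq [FiniteDimensional 𝕜 E] (f : StrongDual 𝕜 (E →L[𝕜] E)) :
    ∃ S : E →ₗ[𝕜] E, S.IsSymmetric ∧ re (S.trace 𝕜 E) = re (f 1) ∧
      ∀ x, re ⟪x, S x⟫_𝕜 = re (f (rankOne 𝕜 x x)) := by
  have : CompleteSpace E := FiniteDimensional.complete 𝕜 E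
  obtain ⟨T, hT⟩ := exists_inner_eq_apply_rankOne f
  let S : E →L[𝕜] E := ((2⁻¹ : ℝ) : 𝕜) • (T + T.adjoint)
  have hsymm : (S : E →ₗ[𝕜] E).IsSymmetric :=
    ContinuousLinearMap.isSelfAdjoint_iff_isSymmetric.mp <|
      IsSelfAdjoint.smul (conj_ofReal _) (IsSelfAdjoint.add_star_self T)
  have hquad (x : E) : re ⟪x, S x⟫_𝕜 = re (f (rankOne 𝕜 x x)) := by
    have hsum : ⟪x, S x⟫_𝕜 = ((2⁻¹ : ℝ) : 𝕜) * (⟪x, T x⟫_𝕜 + ⟪T x, x⟫_𝕜) := by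
      simp only [S, smul_apply, add_apply, inner_smul_right, inner_add_right,
        ContinuousLinearMap.adjoint_inner_right]
    rw [hsum, re_ofReal_mul, map_add, inner_re_symm x, hT]
    ring
  let b := stdOrthonormalBasis 𝕜 E
  have hone : f 1 = ∑ j, f (rankOne 𝕜 (b j) (b j)) := by
    rw [← map_sum, b.sum_rankOne_eq_id, ContinuousLinearMap.one_def]
  refine ⟨S, hsymm, ?_, hquad⟩
  rw [LinearMap.trace_eq_sum_inner _ b, hone, map_sum, map_sum]
  exact Finset.sum_congr rfl fun j _ => hquad (b j)

end Separation

section Spectral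

lemma card_mul_sum_mul_le_sum {κ : Type*} [Fintype κ] {l p : κ → ℝ} {k : κ}
    (hk : ∀ j, l k ≤ l j) (hp : ∀ j, 0 ≤ p j) (hp1 : ∑ j, p j = 1)
    (hpk : Fintype.card κ * (1 - p k) ≤ 1) :
    Fintype.card κ * ∑ j, l j * p j ≤ ∑ j, l j := by
  classical
  have hp_le {j : κ} (hj : j ≠ k) : p j ≤ 1 - p k := by
    have := Finset.add_le_sum (fun i _ => hp i) (Finset.mem_univ j) (Finset.mem_univ k) hj
    linarith
  have hgap_le : ∑ j, (l j - l k) * p j ≤ (∑ j, (l j - l k)) * (1 - p k) := by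
    rw [Finset.sum_mul]
    refine Finset.sum_le_sum fun j _ => ?_
    obtain rfl | hj := eq_or_ne j k
    · simp
    · exact mul_le_mul_of_nonneg_left (hp_le hj) (sub_nonneg.mpr (hk j))
  have hgap_mul : ∑ j, (l j - l k) * p j = ∑ j, l j * p j - l k := by
    simp only [sub_mul, Finset.sum_sub_distrib, ← Finset.mul_sum, hp1, mul_one]
  have hgap : ∑ j, (l j - l k) = ∑ j, l j - Fintype.card κ * l k := by
    simp [Finset.sum_sub_distrib]
  have hgap_nonneg : 0 ≤ ∑ j, (l j - l k) := Finset.sum_nonneg fun j _ => sub_nonneg.mpr (hk j)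
  calc Fintype.card κ * ∑ j, l j * p j
      = Fintype.card κ * l k + Fintype.card κ * ∑ j, (l j - l k) * p j := by
        rw [hgap_mul]; ring
    _ ≤ Fintype.card κ * l k + Fintype.card κ * ((∑ j, (l j - l k)) * (1 - p k)) := by gcongr
    _ = Fintype.card κ * l k + (∑ j, (l j - l k)) * (Fintype.card κ * (1 - p k)) := by ring
    _ ≤ Fintype.card κ * l k + ∑ j, (l j - l k) := by
        gcongr; exact mul_le_of_le_one_right hgap_nonneg hpk
    _ = ∑ j, l j := by rw [hgap]; ring

variable [FiniteDimensional 𝕜 E] {S : E →ₗ[𝕜] E} {n : ℕ}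

lemma re_inner_eq_sum_eigenvalues (hS : S.IsSymmetric) (hn : finrank 𝕜 E = n) (x : E) :
    re ⟪x, S x⟫_𝕜 = ∑ j, hS.eigenvalues hn j * ‖⟪hS.eigenvectorBasis hn j, x⟫_𝕜‖ ^ 2 := by
  let b := hS.eigenvectorBasis hn
  have hb (j : Fin n) : ⟪b j, S x⟫_𝕜 = hS.eigenvalues hn j * ⟪b j, x⟫_𝕜 := by
    simpa only [OrthonormalBasis.repr_apply_apply]
      using hS.eigenvectorBasis_apply_self_apply hn x j
  rw [← b.sum_inner_mul_inner, map_sum]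
  refine Finset.sum_congr rfl fun j _ => ?_
  rw [hb, mul_left_comm, re_ofReal_mul, inner_mul_symm_re_eq_norm, norm_mul, norm_inner_symm, sq]

lemma exists_finrank_mul_re_inner_le_re_trace [Nontrivial E] (hS : S.IsSymmetric) :
    ∃ d : E, ‖d‖ = 1 ∧ ∀ x : E, ‖x‖ = 1 → finrank 𝕜 E * (1 - ‖⟪d, x⟫_𝕜‖ ^ 2) ≤ 1 →
      finrank 𝕜 E * re ⟪x, S x⟫_𝕜 ≤ re (S.trace 𝕜 E) := by
  let b := hS.eigenvectorBasis rfl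
  have : Nonempty (Fin (finrank 𝕜 E)) := Fin.pos_iff_nonempty.mp finrank_pos
  obtain ⟨k, hk⟩ := Finite.exists_min (hS.eigenvalues rfl)
  refine ⟨b k, b.norm_eq_one k, fun x hx hdx => ?_⟩
  have hweights : ∑ j, ‖⟪b j, x⟫_𝕜‖ ^ 2 = 1 := by rw [b.sum_sq_norm_inner_right, hx, one_pow]
  rw [re_inner_eq_sum_eigenvalues hS rfl, hS.re_trace_eq_sum_eigenvalues rfl]
  simpa only [Fintype.card_fin] using card_mul_sum_mul_le_sum hk (fun j => sq_nonneg _) hweights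
    (by simpa only [Fintype.card_fin] using hdx)

end Spectral

section Sufficiency

variable [Fintype ι] {φ : ι → E}

lemma hasTightScaling_of_sum_rankOne_eq {w : ι → ℝ} (hw : ∀ i, 0 ≤ w i) {c : ℝ} (hc : 0 < c)
    (h : ∑ i, (w i : 𝕜) • rankOne 𝕜 (φ i) (φ i) = (c : 𝕜) • 1) : HasTightScaling 𝕜 φ := by
  refine ⟨fun i => √(w i), fun i => Real.sqrt_nonneg _, c, hc, fun x => ?_⟩
  have hsq (i : ι) : ⟪φ i, x⟫_𝕜 * ⟪x, φ i⟫_𝕜 = (‖⟪x, φ i⟫_𝕜‖ ^ 2 : 𝕜) := by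
    rw [← inner_conj_symm, RCLike.conj_mul]
  have hsum : ∑ i, (w i : 𝕜) * ‖⟪x, φ i⟫_𝕜‖ ^ 2 = c * ‖x‖ ^ 2 := by
    simpa [inner_sum, inner_smul_right, hsq] using congrArg (fun T : E →L[𝕜] E => ⟪x, T x⟫_𝕜) h
  have hreal : ∑ i, w i * ‖⟪x, φ i⟫_𝕜‖ ^ 2 = c * ‖x‖ ^ 2 := by exact_mod_cast hsum
  simpa [inner_smul_right, mul_pow, hw] using hreal

lemma hasTightScaling_of_sqrt_le_maxInner [FiniteDimensional 𝕜 E] [Nontrivial E] [Nonempty ι]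
    (hφ : ∀ i, ‖φ i‖ = 1)
    (h : ∀ d, ‖d‖ = 1 → √((finrank 𝕜 E - 1) / finrank 𝕜 E) ≤ maxInner 𝕜 φ d) :
    HasTightScaling 𝕜 φ := by
  have hn : (0 : ℝ) < finrank 𝕜 E := mod_cast finrank_pos
  obtain ⟨w, hw, hsum⟩ | ⟨f, hf⟩ := exists_mem_stdSimplex_or_exists_separating (𝕜 := 𝕜)
    (fun i => rankOne 𝕜 (φ i) (φ i)) ((((finrank 𝕜 E : ℝ)⁻¹ : ℝ) : 𝕜) • 1)
  · exact hasTightScaling_of_sum_rankOne_eq hw.1 (inv_pos.mpr hn) hsum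
  obtain ⟨S, hS, htrace, hquad⟩ := exists_isSymmetric_re_trace_eq f
  obtain ⟨d, hd, hdS⟩ := exists_finrank_mul_re_inner_le_re_trace hS
  obtain ⟨i, hi⟩ := exists_norm_inner_eq_maxInner (𝕜 := 𝕜) φ d
  have hclose : finrank 𝕜 E * (1 - ‖⟪d, φ i⟫_𝕜‖ ^ 2) ≤ 1 := by
    have hsq := (Real.sqrt_le_left (norm_nonneg _)).mp ((h d hd).trans_eq hi.symm)
    rw [div_le_iff₀ hn] at hsq
    linarith
  have hsep : (finrank 𝕜 E : ℝ)⁻¹ * re (S.trace 𝕜 E) < re ⟪φ i, S (φ i)⟫_𝕜 := by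
    rw [htrace, hquad, ← re_ofReal_mul, ← smul_eq_mul, ← map_smul]
    exact hf i
  exact absurd (hdS (φ i) (hφ i) hclose) (not_le.mpr ((inv_mul_lt_iff₀ hn).mp hsep))

end Sufficiency

section RealFrames

variable {M N : ℕ} {Φ : Fin M → EuclideanSpace ℝ (Fin N)}

lemma IsFrame.nonempty [Nonempty (Fin N)] (hΦ : IsFrame Φ) : Nonempty (Fin M) := by
  obtain ⟨A, B, hA, hAB⟩ := hΦ
  obtain ⟨x, hx⟩ := exists_ne (0 : EuclideanSpace ℝ (Fin N))
  by_contra hM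
  have := not_nonempty_iff.mp hM
  have hpos : 0 < A * ‖x‖ ^ 2 := by positivity
  exact absurd (hAB x).1 (by simpa using hpos)

lemma maxCorrelation_eq_maxInner : maxCorrelation Φ = maxInner ℝ Φ := rfl

lemma minMaxCorrelation_eq_minMaxInner : minMaxCorrelation Φ = minMaxInner ℝ Φ := rfl

lemma isScalable_iff : IsScalable Φ ↔ IsFrame Φ ∧ HasTightScaling ℝ Φ := by
  simp only [IsScalable, IsTightFrame, HasFrameBounds, HasTightScaling, HasTightBound,
    ofReal_real_eq_id, id_eq, Real.norm_eq_abs, le_antisymm_iff, and_comm]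

end RealFrames

end ScalableFrames

open ScalableFrames in
theorem theorem4p1_general {𝕜 E ι : Type*} [RCLike 𝕜] [NormedAddCommGroup E]
    [InnerProductSpace 𝕜 E] [FiniteDimensional 𝕜 E] [Nontrivial E] [Fintype ι] [Nonempty ι]
    (φ : ι → E) (hφ : ∀ i, ‖φ i‖ = 1) :
    IsLeast (maxInner 𝕜 φ '' {d | ‖d‖ = 1}) (minMaxInner 𝕜 φ) ∧
    (HasTightScaling 𝕜 φ → 1 / √(Module.finrank 𝕜 E) ≤ minMaxInner 𝕜 φ) ∧
    (√((Module.finrank 𝕜 E - 1) / Module.finrank 𝕜 E) ≤ minMaxInner 𝕜 φ →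
      HasTightScaling 𝕜 φ) := by
  have hleast := isLeast_minMaxInner (𝕜 := 𝕜) φ
  refine ⟨hleast, fun hs => ?_, fun h => ?_⟩
  · obtain ⟨d, hd, hdm⟩ := hleast.1
    exact (hs.one_div_sqrt_le_maxInner hφ hd).trans_eq hdm
  · exact hasTightScaling_of_sqrt_le_maxInner hφ fun d hd => h.trans (hleast.2 ⟨d, hd, rfl⟩)

/-- The first conjunct says that the infimum in `minMaxCorrelation` is attained, so that it is
the minimum in the other two. -/
theorem theorem4p1 (M N : ℕ) (hN : 0 < N) (Φ : Fin M → EuclideanSpace ℝ (Fin N))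
    (hΦ : ScalableFrames.IsUnitNormFrame Φ) :
    IsLeast (ScalableFrames.maxCorrelation Φ '' {d | ‖d‖ = 1})
        (ScalableFrames.minMaxCorrelation Φ) ∧
    (ScalableFrames.IsScalable Φ →
      1 / √(N : ℝ) ≤ ScalableFrames.minMaxCorrelation Φ) ∧
    (√(((N : ℝ) - 1) / (N : ℝ)) ≤ ScalableFrames.minMaxCorrelation Φ →
      ScalableFrames.IsScalable Φ) := by
  have : Nonempty (Fin N) := Fin.pos_iff_nonempty.mp hN
  have : Nonempty (Fin M) := hΦ.1.nonempty
  simpa only [finrank_euclideanSpace_fin, ScalableFrames.maxCorrelation_eq_maxInner,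
    ScalableFrames.minMaxCorrelation_eq_minMaxInner, ScalableFrames.isScalable_iff, hΦ.1, true_and]
    using theorem4p1_general (𝕜 := ℝ) Φ hΦ.2
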